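/- Maps are continuous maps of topological spaces, and $S^1$ is the unit circle in $\mathbb C$ based at $1$. For a (discrete) group $G$, a delooping $BG$ of $G$ is a path-connected space with a base point $\ast$, together with a homotopy equivalence $\Omega BG=\Omega(BG,\ast)\simeq G$ that sends concatenation of loops to the group operation. A pointed map $f:(A,a)\to(B,b)$ is a map $f$ together with a path $\beta$ from $f(a)$ to $b$; it induces $\Omega f:\Omega A\to\Omega B$, $p\mapsto\beta^{-1}\cdot f(p)\cdot\beta$. Given deloopings $BG$, $BH$ and a group morphism $\phi:G\to H$, a delooping $B\phi:BG\to BH$ of $\phi$ is a pointed map for which $\Omega B\phi$ corresponds to $\phi$ under $\Omega BG\simeq G$ and $\Omega BH\simeq H$. The circle is regarded as the delooping $B\mathbb Z$ of $\mathbb Z$, by the winding number. The fiber $\mathrm{fib}_f$ of a map $f:E\to B$ at the base point $b$ of $B$ is the homotopy fiber, i.e. the space of pairs of a point $x\in E$ and a path in $B$ from $f(x)$ to $b$. A sequence $F\xrightarrow{i}E\xrightarrow{f}B$ is a fiber sequence if there is a homotopy from $f\circ i$ to the constant map at $b$ such that the induced map $F\to\mathrm{fib}_f$ is a homotopy equivalence.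 For a natural number $k$, $kA$ is the disjoint union of $k$ copies of a space $A$, and, for $g:A\to B$, $kg:kA\to B$ is the map equal to $g$ on each copy. **Proposition.** Let $m\ge 1$ be an integer, let $l$ be an arbitrary integer, and let $k=\gcd(l,m)$. Let $B\mathbb Z_m$ be any delooping of $\mathbb Z_m=\mathbb Z/m\mathbb Z$, and let $B\phi^l:S^1\to B\mathbb Z_m$ be any delooping of the group morphism $\phi^l:\mathbb Z\to\mathbb Z_m$ with $\phi^l(1)=l$. Then the fiber of $B\phi^l$ at the base point is homotopy equivalent to $kS^1$. Moreover, for any delooping $B\mu_{m/k}:S^1\to S^1$ of the multiplication $\mu_{m/k}:\mathbb Z\to\mathbb Z$ by $m/k$, $$kS^1\xrightarrow{\;kB\mu_{m/k}\;}S^1\xrightarrow{\;B\phi^l\;}B\mathbb Z_m$$ is a fiber sequence. -/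

import Mathlib

open scoped ContinuousMap unitInterval

noncomputable section

namespace FibSeq

/-! ### Pointed maps, deloopings of groups and of group morphisms -/

/-- A pointed map from `(A, a)` to `(B, b)`: a continuous map `f` with a path from `f a` to `b`. -/
structure PointedMap {A B : Type*} [TopologicalSpace A] [TopologicalSpace B] (a : A) (b : B) where
  toMap : C(A, B)
  basePath : Path (toMap a) b

/-- The map induced by a pointed map on loop spaces: `p ↦ basePath⁻¹ ⬝ f(p) ⬝ basePath`. -/
def PointedMap.loopMap {A B : Type*} [TopologicalSpace A] [TopologicalSpace B] {a : A} {b : B}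
    (f : PointedMap a b) (p : Path a a) : Path b b :=
  f.basePath.symm.trans ((p.map f.toMap.continuous).trans f.basePath)

/-- A delooping of a (discrete, additively written) group `G` on a space `X`: `X` is path-connected
with a base point, and its loop space is homotopy equivalent to `G` by an equivalence
which sends concatenation of loops to addition. -/
structure Delooping (G : Type*) [AddGroup G] [TopologicalSpace G] [DiscreteTopology G]
    (X : Type*) [TopologicalSpace X] where
  base : X
  connected : PathConnectedSpace X
  loopEquiv : Path base base ≃ₕ G
  loopEquiv_trans : ∀ p q : Path base base,
    loopEquiv (p.trans q) = loopEquiv p + loopEquiv q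

/-- The pointed map `f : BG → BH` deloops the group morphism `φ : G → H`:
the map induced by `f` on loop spaces corresponds to `φ` under `ΩBG ≃ G` and `ΩBH ≃ H`. -/
def Deloops {G H X Y : Type*} [AddGroup G] [TopologicalSpace G] [DiscreteTopology G]
    [AddGroup H] [TopologicalSpace H] [DiscreteTopology H]
    [TopologicalSpace X] [TopologicalSpace Y]
    (BG : Delooping G X) (BH : Delooping H Y) (f : PointedMap BG.base BH.base) (φ : G →+ H) :
    Prop :=
  ∀ p : Path BG.base BG.base, BH.loopEquiv (f.loopMap p) = φ (BG.loopEquiv p)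

/-! ### Fibers, fiber sequences, disjoint copies -/

/-- The homotopy fiber of `f` at `b`: the space of pairs of a point `x` of `E` and
a path in `B` from `f x` to `b`. -/
def HFiber {E B : Type*} [TopologicalSpace E] [TopologicalSpace B] (f : C(E, B)) (b : B) : Type _ :=
  {p : E × C(I, B) // p.2 0 = f p.1 ∧ p.2 1 = b}

instance {E B : Type*} [TopologicalSpace E] [TopologicalSpace B] (f : C(E, B)) (b : B) :
    TopologicalSpace (HFiber f b) :=
  inferInstanceAs (TopologicalSpace {p : E × C(I, B) // p.2 0 = f p.1 ∧ p.2 1 = b})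

/-- The map to the homotopy fiber induced by a map `i : F → E` and
a homotopy from `f ∘ i` to the constant map at `b`. -/
def toHFiber {F E B : Type*} [TopologicalSpace F] [TopologicalSpace E] [TopologicalSpace B]
    (i : C(F, E)) (f : C(E, B)) (b : B)
    (H : (f.comp i).Homotopy (ContinuousMap.const F b)) : C(F, HFiber f b) where
  toFun x := ⟨(i x, (H.toContinuousMap.comp ContinuousMap.prodSwap).curry x),
    H.apply_zero x, H.apply_one x⟩
  continuous_toFun := Continuous.subtype_mk
    (i.continuous.prodMk (ContinuousMap.continuous _)) _

/-- `F --i--> E --f--> B` is a (homotopy) fiber sequence over the base point `b`: there is a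
homotopy from `f ∘ i` to the constant map at `b` for which the induced map from `F` to the
homotopy fiber of `f` is a homotopy equivalence, i.e. `i` is the homotopy pullback of `b : 1 → B`
along `f`. -/
def IsFiberSequence {F E B : Type*} [TopologicalSpace F] [TopologicalSpace E] [TopologicalSpace B]
    (i : C(F, E)) (f : C(E, B)) (b : B) : Prop :=
  ∃ (H : (f.comp i).Homotopy (ContinuousMap.const F b)) (e : F ≃ₕ HFiber f b),
    e.toFun = toHFiber i f b H

/-- The space `k A`, the disjoint union of `k` copies of `A`. -/
abbrev Copies (k : ℕ) (A : Type*) : Type _ := Σ _ : Fin k, A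

/-- The map `k A → B` which is `g : A → B` on each copy of `A`. -/
def copiesMap (k : ℕ) {A B : Type*} [TopologicalSpace A] [TopologicalSpace B] (g : C(A, B)) :
    C(Copies k A, B) where
  toFun x := g x.2
  continuous_toFun := continuous_sigma fun _ => g.continuous

/-! ### The circle as a delooping of `ℤ` -/

/-- The lift to `ℝ`, starting at `0`, of a loop of the circle, along `t ↦ exp (t * I)`. -/
def angleLift (γ : Path (1 : Circle) 1) : C(I, ℝ) :=
  Circle.isCoveringMap_exp.liftPath γ 0 (by simp)

theorem exp_angleLift (γ : Path (1 : Circle) 1) (t : I) : Circle.exp (angleLift γ t) = γ t :=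
  congrFun (Circle.isCoveringMap_exp.liftPath_lifts (γ : C(I, Circle)) 0 (by simp)) t

theorem angleLift_zero (γ : Path (1 : Circle) 1) : angleLift γ 0 = 0 :=
  Circle.isCoveringMap_exp.liftPath_zero (γ : C(I, Circle)) 0 (by simp)

theorem angleLift_eq (γ : Path (1 : Circle) 1) (Γ : C(I, ℝ)) (h : ∀ t, Circle.exp (Γ t) = γ t)
    (h0 : Γ 0 = 0) : angleLift γ = Γ :=
  ((Circle.isCoveringMap_exp.eq_liftPath_iff' (γ := (γ : C(I, Circle))) (e := (0 : ℝ))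
    (by simp)).2 ⟨funext h, h0⟩).symm

theorem continuous_angleLift :
    Continuous fun x : I × Path (1 : Circle) 1 => angleLift x.2 x.1 :=
  (Circle.isCoveringMap_exp.liftHomotopy
    (A := Path (1 : Circle) 1)
    (⟨fun x => x.2 x.1, by fun_prop⟩ : C(I × Path (1 : Circle) 1, Circle))
    (ContinuousMap.const _ 0) (by simp)).continuous

theorem exists_angleLift_one (γ : Path (1 : Circle) 1) :
    ∃ n : ℤ, angleLift γ 1 = n * (2 * Real.pi) :=
  Circle.exp_eq_one.1 ((exp_angleLift γ 1).trans γ.target)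

/-- The winding number of a loop of the circle. -/
def winding (γ : Path (1 : Circle) 1) : ℤ := (exists_angleLift_one γ).choose

theorem winding_spec (γ : Path (1 : Circle) 1) :
    angleLift γ 1 = winding γ * (2 * Real.pi) :=
  (exists_angleLift_one γ).choose_spec

theorem winding_eq (γ : Path (1 : Circle) 1) (n : ℤ) (h : angleLift γ 1 = n * (2 * Real.pi)) :
    winding γ = n := by
  have := (winding_spec γ).symm.trans h
  exact_mod_cast mul_right_cancel₀ Real.two_pi_pos.ne' this

theorem continuous_winding : Continuous winding := by
  rw [Int.isClosedEmbedding_coe_real.isEmbedding.continuous_iff]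
  have h : (fun γ : Path (1 : Circle) 1 => angleLift γ 1 / (2 * Real.pi)) =
      (fun n : ℤ => (n : ℝ)) ∘ winding := by
    funext γ
    simp [winding_spec, Real.pi_ne_zero]
  rw [← h]
  exact (continuous_angleLift.comp (Continuous.prodMk_right (1 : I))).div_const _

/-- The loop `t ↦ exp (2 π n t i)` of the circle. -/
def circleLoop (n : ℤ) : Path (1 : Circle) 1 where
  toFun t := Circle.exp (t * (n * (2 * Real.pi)))
  continuous_toFun := by fun_prop
  source' := by simp
  target' := by simp

theorem angleLift_circleLoop (n : ℤ) (t : I) :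
    angleLift (circleLoop n) t = t * (n * (2 * Real.pi)) := by
  rw [angleLift_eq (circleLoop n) ⟨fun t => t * (n * (2 * Real.pi)), by fun_prop⟩
    (fun _ => rfl) (by simp)]
  rfl

theorem winding_circleLoop (n : ℤ) : winding (circleLoop n) = n :=
  winding_eq _ _ (by simp [angleLift_circleLoop])

theorem winding_trans (p q : Path (1 : Circle) 1) :
    winding (p.trans q) = winding p + winding q := by
  let P : Path (0 : ℝ) (angleLift p 1) := ⟨angleLift p, angleLift_zero p, rfl⟩
  let Q : Path (angleLift p 1) (angleLift p 1 + angleLift q 1) :=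
    ⟨⟨fun t => angleLift p 1 + angleLift q t, by fun_prop⟩, by simp [angleLift_zero], rfl⟩
  apply winding_eq
  rw [angleLift_eq (p.trans q) (P.trans Q : Path _ _)]
  · simp only [ContinuousMap.coe_coe, Path.target]
    rw [winding_spec, winding_spec]
    push_cast
    ring
  · intro t
    simp only [ContinuousMap.coe_coe, Path.trans_apply]
    split_ifs
    · exact exp_angleLift p _
    · change Circle.exp (angleLift p 1 + angleLift q _) = _
      rw [Circle.exp_add, exp_angleLift, exp_angleLift, p.target, one_mul]
  · simp

/-- The straight-line homotopy between the lifts of a loop of the circle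
and of the standard loop with the same winding number. -/
def straighten (s : I) (γ : Path (1 : Circle) 1) : Path (1 : Circle) 1 where
  toFun t := Circle.exp ((1 - s) * (t * (winding γ * (2 * Real.pi))) + s * angleLift γ t)
  continuous_toFun := by fun_prop
  source' := by simp [angleLift_zero]
  target' := by
    rw [winding_spec]
    have : (1 - (s : ℝ)) * (((1 : I) : ℝ) * (winding γ * (2 * Real.pi)))
        + s * (winding γ * (2 * Real.pi)) = winding γ * (2 * Real.pi) := by
      simp only [Set.Icc.coe_one]
      ring
    rw [this]
    exact Circle.exp_int_mul_two_pi _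

theorem continuous_straighten :
    Continuous fun x : I × Path (1 : Circle) 1 => straighten x.1 x.2 := by
  rw [← Path.continuous_uncurry_iff]
  have h1 : Continuous fun x : (I × Path (1 : Circle) 1) × I => (winding x.1.2 : ℝ) :=
    Int.isClosedEmbedding_coe_real.continuous.comp
      (continuous_winding.comp (continuous_snd.comp continuous_fst))
  have h2 : Continuous fun x : (I × Path (1 : Circle) 1) × I => angleLift x.1.2 x.2 :=
    continuous_angleLift.comp (continuous_snd.prodMk (continuous_snd.comp continuous_fst))
  refine Circle.exp.continuous.comp (f := fun x : (I × Path (1 : Circle) 1) × I =>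
    (1 - (x.1.1 : ℝ)) * (x.2 * (winding x.1.2 * (2 * Real.pi))) + x.1.1 * angleLift x.1.2 x.2) ?_
  fun_prop

/-- The loop space of the circle is homotopy equivalent to `ℤ`, by the winding number. -/
def circleLoopEquiv : Path (1 : Circle) 1 ≃ₕ ℤ where
  toFun := ⟨winding, continuous_winding⟩
  invFun := ⟨circleLoop, continuous_of_discreteTopology⟩
  left_inv := ⟨{
    toFun := fun x => straighten x.1 x.2
    continuous_toFun := continuous_straighten
    map_zero_left := fun γ => by
      ext t
      simp [straighten, circleLoop]
    map_one_left := fun γ => by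
      ext t
      simp [straighten, exp_angleLift] }⟩
  right_inv := by
    have : (ContinuousMap.comp ⟨winding, continuous_winding⟩
        ⟨circleLoop, continuous_of_discreteTopology⟩ : C(ℤ, ℤ)) = ContinuousMap.id ℤ := by
      ext n
      exact winding_circleLoop n
    rw [this]

/-- The circle, with base point `1`, as a delooping of `ℤ`: the loop `t ↦ exp (2 π n t i)`
corresponds to `n`. -/
def circleDelooping : Delooping ℤ Circle where
  base := 1
  connected := Circle.exp_surjective.pathConnectedSpace Circle.exp.continuous
  loopEquiv := circleLoopEquiv
  loopEquiv_trans := winding_trans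

end FibSeq

end

/-! Let `n = m / k`, the order of `l` in `ℤ/m`, and let `p` be the `n`-th power map of the circle.
Since `n • l = 0`, `f ∘ p` has a null-homotopy `K`, which makes the fiber of `f ∘ p` equivalent to
`S¹ × ℤ/m`; the second coordinate is `offset`. The map from the fiber of `f ∘ p` to that of `f` is a
pullback of the covering `p`: the lifts of a point differ by rotations through `a / n` of a turn,
and such a rotation adds `a • l` to the offset (`offset_rotate`). Hence exactly one lift has its
offset among chosen representatives of the `k` cosets of `⟨l⟩`. The part of the fiber of `f ∘ p`
with these offsets is therefore homeomorphic to the fiber of `f`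
(`isFiberSequence_of_existsUnique_lift`), and it is equivalent to `k` circles (`offsetEquiv`). Any
delooping of multiplication by `n` is homotopic to `p` (`homotopic_powMap`), and being a fiber
sequence depends only on the homotopy class of the first map. -/

noncomputable section

namespace FibSeq

/-! ### Paths -/

/-- A square in `Y` gives a homotopy between the two composites of its sides. -/
theorem homotopic_of_square {Y : Type*} [TopologicalSpace Y] {a b c d : Y} (F : I × I → Y)
    (hF : Continuous F) (p : Path a b) (q : Path b d) (r : Path a c) (s : Path c d)
    (hp : ∀ t, p t = F (0, t)) (hq : ∀ t, q t = F (t, 1)) (hr : ∀ t, r t = F (t, 0))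
    (hs : ∀ t, s t = F (1, t)) : (p.trans q).Homotopic (r.trans s) := by
  obtain rfl : a = F (0, 0) := by rw [← hp, p.source]
  obtain rfl : b = F (0, 1) := by rw [← hp, p.target]
  obtain rfl : c = F (1, 0) := by rw [← hs, s.source]
  obtain rfl : d = F (1, 1) := by rw [← hs, s.target]
  have key : ∀ u v w : I × I, ∀ (α : Path u v) (α' : Path v w) (β : Path (F u) (F v))
      (β' : Path (F v) (F w)), (∀ t, β t = F (α t)) → (∀ t, β' t = F (α' t)) →
      β.trans β' = (α.trans α').map hF := by
    intro u v w α α' β β' h h'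
    rw [Path.map_trans]
    congr 1 <;> ext t <;> simp [h, h']
  rw [key (0, 0) (0, 1) (1, 1) ((Path.refl 0).prod Path.id) (Path.id.prod (Path.refl 1)) p q hp hq,
    key (0, 0) (1, 0) (1, 1) (Path.id.prod (Path.refl 0)) ((Path.refl 1).prod Path.id) r s hr hs]
  -- The square is simply connected, so its two boundary routes from `(0, 0)` to `(1, 1)` are
  -- homotopic.
  have : ContractibleSpace I := (convex_Icc (0 : ℝ) 1).contractibleSpace ⟨0, by simp⟩
  exact (SimplyConnectedSpace.paths_homotopic
    (((Path.refl (0 : I)).prod Path.id).trans (Path.id.prod (Path.refl (1 : I))))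
    ((Path.id.prod (Path.refl (0 : I))).trans ((Path.refl (1 : I)).prod Path.id))).map ⟨F, hF⟩

/-! ### Path homotopies depending continuously on the paths -/

section Reparametrization

variable {Y : Type*} [TopologicalSpace Y] {a b c : Y}

/-- The homotopy, in the parameter `s`, from `p ⬝ (p⁻¹ ⬝ q)` to `q`. -/
def cancelLeft (p : Path a b) (q : Path a c) (s : I) : Path a c where
  -- Every stage runs along `p⁻¹ ⬝ q` from time `1 / 2` to time `1`. At `s = 0` the clock first goes
  -- back to `0`, tracing `p`, and then forward to `1`; at `s = 1` it only traces `q`.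
  toFun t := (p.symm.trans q).extend
    ((1 - s) * max (1 / 2 - t : ℝ) (2 * t - 1) + s * ((1 + t) / 2))
  continuous_toFun := by
    have := (p.symm.trans q).continuous_extend
    fun_prop
  source' := by
    have h : (1 - (s : ℝ)) * max (1 / 2 - ((0 : I) : ℝ)) (2 * ((0 : I) : ℝ) - 1)
        + s * ((1 + ((0 : I) : ℝ)) / 2) = 1 / 2 := by
      rw [max_eq_left] <;> norm_num
      ring
    rw [h, Path.extend_trans_of_le_half _ _ le_rfl]
    norm_num
  target' := by
    have h : (1 - (s : ℝ)) * max (1 / 2 - ((1 : I) : ℝ)) (2 * ((1 : I) : ℝ) - 1)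
        + s * ((1 + ((1 : I) : ℝ)) / 2) = 1 := by
      rw [max_eq_right] <;> norm_num
    rw [h, Path.extend_one]

theorem cancelLeft_zero (p : Path a b) (q : Path a c) :
    cancelLeft p q 0 = p.trans (p.symm.trans q) := by
  ext t
  rw [← Path.extend_extends' (p.trans _)]
  simp only [cancelLeft, Path.coe_mk_mk, Set.Icc.coe_zero, sub_zero, one_mul, zero_mul, add_zero]
  have h0 := t.2.1
  have h1 := t.2.2
  rcases le_total (t : ℝ) (1 / 2) with h | h
  · rw [max_eq_left (by linarith), Path.extend_trans_of_le_half _ _ (by linarith),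
      Path.extend_trans_of_le_half _ _ h, Path.extend_symm_apply]
    congr 1
    ring
  · rw [max_eq_right (by linarith), Path.extend_trans_of_half_le _ _ h]

theorem cancelLeft_one (p : Path a b) (q : Path a c) : cancelLeft p q 1 = q := by
  ext t
  rw [← Path.extend_extends' q]
  have h0 := t.2.1
  simp only [cancelLeft, Path.coe_mk_mk, Set.Icc.coe_one, sub_self, one_mul, zero_mul, zero_add]
  rw [Path.extend_trans_of_half_le _ _ (by linarith)]
  congr 1
  ring

/-- The path `p ⬝ q` from its point at time `s / 2` on. -/
def dropInitial (p : Path a b) (q : Path b c) (s : I) : Path (p s) c where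
  toFun t := (p.trans q).extend (s / 2 + t * (1 - s / 2))
  continuous_toFun := by
    have := (p.trans q).continuous_extend
    fun_prop
  source' := by
    have := s.2.2
    rw [Path.extend_trans_of_le_half _ _ (by norm_num; try linarith), ← Path.extend_extends' p]
    congr 1
    norm_num
    ring
  target' := by simp

theorem dropInitial_one (p : Path a b) (q : Path b c) (t : I) : dropInitial p q 1 t = q t := by
  rw [← Path.extend_extends' q]
  have h0 := t.2.1
  simp only [dropInitial, Path.coe_mk_mk, Set.Icc.coe_one]
  rw [Path.extend_trans_of_half_le _ _ (by linarith)]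
  congr 1
  ring

variable {T : Type*} [TopologicalSpace T]

theorem continuous_cancelLeft {a b c : T → Y} {p : ∀ y, Path (a y) (b y)}
    {q : ∀ y, Path (a y) (c y)} (hp : Continuous ↿p) (hq : Continuous ↿q) :
    Continuous fun x : (I × T) × I => cancelLeft (p x.1.2) (q x.1.2) x.1.1 x.2 := by
  have h := Path.trans_continuous_family _ (Path.symm_continuous_family _ hp) _ hq
  have := (Path.continuous_uncurry_extend_of_continuous_family _ h).comp
    (f := fun x : (I × T) × I => (x.1.2, (1 - (x.1.1 : ℝ)) * max (1 / 2 - x.2 : ℝ) (2 * x.2 - 1)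
      + x.1.1 * ((1 + x.2) / 2))) (by fun_prop)
  exact this

theorem continuous_dropInitial {a b c : T → Y} {p : ∀ y, Path (a y) (b y)}
    {q : ∀ y, Path (b y) (c y)} (hp : Continuous ↿p) (hq : Continuous ↿q) :
    Continuous fun x : (I × T) × I => dropInitial (p x.1.2) (q x.1.2) x.1.1 x.2 := by
  have h := Path.trans_continuous_family _ hp _ hq
  have := (Path.continuous_uncurry_extend_of_continuous_family _ h).comp
    (f := fun x : (I × T) × I => (x.1.2, (x.1.1 / 2 + x.2 * (1 - x.1.1 / 2) : ℝ))) (by fun_prop)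
  exact this

end Reparametrization

theorem continuous_evalAt {E B : Type*} [TopologicalSpace E] [TopologicalSpace B] {f g : C(E, B)}
    (K : f.Homotopy g) : Continuous ↿(fun x => K.evalAt x) :=
  K.continuous.comp continuous_swap

/-- The path to the base point traced by a point under a null-homotopy. -/
def nullPath {E B : Type*} [TopologicalSpace E] [TopologicalSpace B] {f : C(E, B)} {b : B}
    (K : f.Homotopy (ContinuousMap.const E b)) (x : E) : Path (f x) b :=
  K.evalAt x

theorem continuous_nullPath {E B T : Type*} [TopologicalSpace E] [TopologicalSpace B]
    [TopologicalSpace T] {f : C(E, B)} {b : B} (K : f.Homotopy (ContinuousMap.const E b))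
    {u : T → E} (hu : Continuous u) : Continuous ↿(fun y => nullPath K (u y)) :=
  (continuous_evalAt K).comp (hu.prodMap continuous_id)

/-! ### Deloopings and homotopy classes of loops -/

namespace Delooping

variable {G : Type*} [AddGroup G] [TopologicalSpace G] [DiscreteTopology G]
  {X : Type*} [TopologicalSpace X] (D : Delooping G X)

/-- Homotopies in a discrete space are constant, so the homotopy inverse is a strict right inverse.
-/
theorem loopEquiv_symm_apply (j : G) : D.loopEquiv (D.loopEquiv.symm j) = j := by
  obtain ⟨H⟩ := D.loopEquiv.right_inv
  have h := PreconnectedSpace.constant (Y := G) inferInstance (f := fun t : I => H (t, j))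
    (by fun_prop) (x := 0) (y := 1)
  simpa using h

/-- This identifies `G` with the fundamental group: tracks of the homotopy `left_inv` are path
homotopies, and a continuous family of loops has constant image in the discrete `G`. -/
theorem loopEquiv_eq_iff {p q : Path D.base D.base} :
    D.loopEquiv p = D.loopEquiv q ↔ p.Homotopic q := by
  constructor
  · intro h
    obtain ⟨H⟩ := D.loopEquiv.left_inv
    have key : ∀ r, (D.loopEquiv.symm (D.loopEquiv r)).Homotopic r := fun r => ⟨
      { toFun := fun x => H (x.1, r) x.2
        continuous_toFun := by fun_prop
        map_zero_left := fun t => by simp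
        map_one_left := fun t => by simp
        prop' := by
          rintro t x (rfl | rfl) <;> simp }⟩
    exact (key p).symm.trans (h ▸ key q)
  · rintro ⟨H⟩
    have hc : Continuous fun t : I => H.eval t := by
      rw [← Path.continuous_uncurry_iff]
      exact H.continuous
    have h := PreconnectedSpace.constant (Y := G) inferInstance
      (f := fun t : I => D.loopEquiv (H.eval t))
      (D.loopEquiv.continuous.comp hc) (x := 0) (y := 1)
    simpa using h

theorem loopEquiv_refl : D.loopEquiv (Path.refl D.base) = 0 := by
  have h := D.loopEquiv_trans (Path.refl _) (Path.refl _)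
  rw [Path.refl_trans_refl] at h
  simpa using h

theorem loopEquiv_symm (p : Path D.base D.base) : D.loopEquiv p.symm = -D.loopEquiv p := by
  rw [eq_neg_iff_add_eq_zero, ← D.loopEquiv_trans, ← D.loopEquiv_refl, loopEquiv_eq_iff]
  exact Path.Homotopic.symm_trans p

end Delooping

/-! ### Homotopy fibers -/

namespace HFiber

variable {E B : Type*} [TopologicalSpace E] [TopologicalSpace B] {f : C(E, B)} {b : B}

/-- The point of the total space underlying a point of the homotopy fiber. -/
def point (y : HFiber f b) : E := y.1.1

/-- The path underlying a point of the homotopy fiber. -/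
def path (y : HFiber f b) : Path (f y.point) b := ⟨y.1.2, y.2.1, y.2.2⟩

/-- The point of the homotopy fiber given by a point of the total space and a path. -/
def mk (x : E) (p : Path (f x) b) : HFiber f b := ⟨(x, p.toContinuousMap), p.source, p.target⟩

theorem ext {y y' : HFiber f b} (h : y.point = y'.point) (h' : ∀ t, y.path t = y'.path t) :
    y = y' :=
  Subtype.ext (Prod.ext h (ContinuousMap.ext h'))

theorem continuous_point : Continuous (point : HFiber f b → E) :=
  continuous_fst.comp continuous_subtype_val

theorem continuous_path : Continuous ↿(fun y : HFiber f b => y.path) := by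
  have h : Continuous fun x : HFiber f b × I => x.1.1.2 x.2 :=
    ((continuous_snd.comp continuous_subtype_val).comp continuous_fst).eval continuous_snd
  exact h

theorem continuous_mk {T : Type*} [TopologicalSpace T] {u : T → E} (hu : Continuous u)
    {P : ∀ y, Path (f (u y)) b} (hP : Continuous ↿P) :
    Continuous fun y => (mk (u y) (P y) : HFiber f b) :=
  Continuous.subtype_mk
    (hu.prodMk (ContinuousMap.curry ⟨fun x : T × I => P x.1 x.2, hP⟩).continuous) _

/-- The map of homotopy fibers given by a map `p` of total spaces. -/
def total {E' : Type*} [TopologicalSpace E'] (p : C(E', E)) (y : HFiber (f.comp p) b) :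
    HFiber f b :=
  mk (p y.point) y.path

/-- The map is the restriction of `p × id` on `E' × C(I, B)` over the subset that defines the fiber
of `f`, and proper maps are universally closed. -/
theorem isClosedMap_total {E' : Type*} [TopologicalSpace E'] {p : C(E', E)} (hp : IsProperMap p) :
    IsClosedMap (total p : HFiber (f.comp p) b → HFiber f b) :=
  (hp.universally_closed C(I, B)).restrictPreimage
    {q : E × C(I, B) | q.2 0 = f q.1 ∧ q.2 1 = b}

theorem continuous_total {E' : Type*} [TopologicalSpace E'] (p : C(E', E)) :
    Continuous (total p : HFiber (f.comp p) b → HFiber f b) :=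
  continuous_mk (p.continuous.comp continuous_point) continuous_path

end HFiber

theorem IsFiberSequence.of_homotopic {F E B : Type*} [TopologicalSpace F] [TopologicalSpace E]
    [TopologicalSpace B] {i i' : C(F, E)} {f : C(E, B)} {b : B} (h : IsFiberSequence i f b)
    (hi : i'.Homotopic i) : IsFiberSequence i' f b := by
  obtain ⟨H, e, he⟩ := h
  obtain ⟨J⟩ := hi
  let P : ∀ x, Path (f (i' x)) (f (i x)) := fun x => (J.evalAt x).map f.continuous
  have hP : Continuous ↿P := f.continuous.comp (continuous_evalAt J)
  let Q := fun x => H.evalAt x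
  have hQ : Continuous ↿Q := continuous_evalAt H
  have hD : Continuous fun x : (I × F) × I => dropInitial (P x.1.2) (Q x.1.2) x.1.1 x.2 :=
    continuous_dropInitial hP hQ
  let H' : (f.comp i').Homotopy (ContinuousMap.const F b) :=
    { toFun := fun x => dropInitial (P x.2) (Q x.2) 0 x.1
      continuous_toFun := hD.comp (f := fun x : I × F => ((0, x.2), x.1)) (by fun_prop)
      map_zero_left := fun x => (dropInitial (P x) (Q x) 0).source.trans (P x).source
      map_one_left := fun x => (dropInitial (P x) (Q x) 0).target }
  -- At time `s` the point has moved along `J` to `J (s, x)`, and its path is what then remains of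
  -- `P x ⬝ Q x`.
  have hh : (toHFiber i' f b H').Homotopic (toHFiber i f b H) := ⟨
    { toFun := fun x => HFiber.mk (J x) (dropInitial (P x.2) (Q x.2) x.1)
      continuous_toFun := HFiber.continuous_mk J.continuous hD
      map_zero_left := fun x => HFiber.ext (J.apply_zero x) fun t => rfl
      map_one_left := fun x => HFiber.ext (J.apply_one x) fun t => dropInitial_one _ _ t }⟩
  rw [← he] at hh
  exact ⟨H', ⟨toHFiber i' f b H', e.invFun,
    ((ContinuousMap.Homotopic.refl e.invFun).comp hh).trans e.left_inv,
    (hh.comp (ContinuousMap.Homotopic.refl e.invFun)).trans e.right_inv⟩, rfl⟩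

/-! ### Homotopy fibers of null-homotopic maps -/

section Nullhomotopic

variable {G : Type*} [AddGroup G] [TopologicalSpace G] [DiscreteTopology G]
  {X E : Type*} [TopologicalSpace X] [TopologicalSpace E] {D : Delooping G X} {h : C(E, X)}
  (K : h.Homotopy (ContinuousMap.const E D.base))

/-- The class in `G` of the loop obtained from a point of the homotopy fiber of a map `h`
by a null-homotopy of `h`. -/
def offset (y : HFiber h D.base) : G :=
  D.loopEquiv ((nullPath K y.point).symm.trans y.path)

theorem continuous_offset_loop :
    Continuous fun y : HFiber h D.base =>
      ((nullPath K y.point).symm.trans y.path : Path D.base D.base) := by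
  rw [← Path.continuous_uncurry_iff]
  refine Path.trans_continuous_family _ (Path.symm_continuous_family _ ?_) _ HFiber.continuous_path
  exact continuous_nullPath K HFiber.continuous_point

theorem continuous_offset : Continuous (offset K) :=
  D.loopEquiv.continuous.comp (continuous_offset_loop K)

/-- The point of the homotopy fiber of a map `h` given by a loop and a null-homotopy of `h`. -/
def twist (x : E) (ω : Path D.base D.base) : HFiber h D.base :=
  HFiber.mk x ((nullPath K x).trans ω)

theorem continuous_twist {T : Type*} [TopologicalSpace T] {u : T → E} (hu : Continuous u)
    {ω : T → Path D.base D.base} (hω : Continuous ω) :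
    Continuous fun y => twist K (u y) (ω y) := by
  refine HFiber.continuous_mk hu (Path.trans_continuous_family _ ?_ _
    (Path.continuous_uncurry_iff.2 hω))
  exact continuous_nullPath K hu

theorem offset_twist (x : E) (ω : Path D.base D.base) :
    offset K (twist K x ω) = D.loopEquiv ω := by
  rw [offset, Delooping.loopEquiv_eq_iff]
  refine (Path.Homotopic.trans_assoc _ _ _).symm.trans ?_
  exact ((Path.Homotopic.symm_trans _).hcomp (.refl _)).trans (Path.Homotopic.refl_trans _)

/-- The chosen loop of class `offset K y` is deformed to the actual loop `K⁻¹ ⬝ y.path` by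
`left_inv`, and then `K ⬝ (K⁻¹ ⬝ y.path)` is contracted to `y.path`. -/
theorem exists_homotopy_twist : ∃ H : C(I × HFiber h D.base, HFiber h D.base),
    (∀ y, H (0, y) = twist K y.point (D.loopEquiv.symm (offset K y))) ∧ (∀ y, H (1, y) = y) := by
  obtain ⟨L⟩ := D.loopEquiv.left_inv
  let loop := fun y : HFiber h D.base =>
    ((nullPath K y.point).symm.trans y.path : Path D.base D.base)
  have hloop : Continuous loop := continuous_offset_loop K
  let e₀ : C(HFiber h D.base, HFiber h D.base) :=
    ⟨fun y => twist K y.point (D.loopEquiv.symm (offset K y)), continuous_twist K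
      HFiber.continuous_point (D.loopEquiv.symm.continuous.comp (continuous_offset K))⟩
  let e₁ : C(HFiber h D.base, HFiber h D.base) :=
    ⟨fun y => twist K y.point (loop y), continuous_twist K HFiber.continuous_point hloop⟩
  let A : e₀.Homotopy e₁ :=
    { toFun := fun x => twist K x.2.point (L (x.1, loop x.2))
      continuous_toFun := continuous_twist K (HFiber.continuous_point.comp continuous_snd)
        (L.continuous.comp (continuous_fst.prodMk (hloop.comp continuous_snd)))
      map_zero_left := fun y => by
        rw [L.apply_zero]
        rfl
      map_one_left := fun y => by
        rw [L.apply_one]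
        rfl }
  have hc := continuous_cancelLeft
    (p := fun y : HFiber h D.base => nullPath K y.point) (q := fun y => y.path)
    (continuous_nullPath K HFiber.continuous_point)
    HFiber.continuous_path
  let C : e₁.Homotopy (ContinuousMap.id _) :=
    { toFun := fun x => HFiber.mk x.2.point (cancelLeft (nullPath K x.2.point) x.2.path x.1)
      continuous_toFun := HFiber.continuous_mk (HFiber.continuous_point.comp continuous_snd) hc
      map_zero_left := fun y => by
        rw [cancelLeft_zero]
        rfl
      map_one_left := fun y => by
        rw [cancelLeft_one]
        rfl }
  exact ⟨(A.trans C).toContinuousMap, (A.trans C).apply_zero, (A.trans C).apply_one⟩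

variable {k : ℕ} {φ : Fin k → G} (hφ : Function.Injective φ)

/-- The part of the homotopy fiber of a null-homotopic map with offset in the range of an injective
family `φ` of `k` elements of `G` is homotopy equivalent to `k` copies of the source of the map. -/
def offsetEquiv : Copies k E ≃ₕ {y : HFiber h D.base // offset K y ∈ Set.range φ} where
  toFun :=
    { toFun := fun x => ⟨twist K x.2 (D.loopEquiv.symm (φ x.1)), by
        rw [offset_twist, D.loopEquiv_symm_apply]
        exact ⟨x.1, rfl⟩⟩
      continuous_toFun := by
        refine continuous_sigma fun j => Continuous.subtype_mk ?_ _
        exact continuous_twist K continuous_id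
          (continuous_const (y := D.loopEquiv.symm (φ j))) }
  invFun :=
    { toFun := fun y => ⟨(Equiv.ofInjective φ hφ).symm ⟨offset K y.1, y.2⟩, y.1.point⟩
      continuous_toFun := by
        have h1 : Continuous fun x : Fin k × E => (⟨x.1, x.2⟩ : Copies k E) :=
          continuous_prod_of_discrete_left.2 fun j =>
            @continuous_sigmaMk (Fin k) (fun _ => E) _ j
        exact h1.comp (Continuous.prodMk
          ((continuous_of_discreteTopology (f := (Equiv.ofInjective φ hφ).symm)).comp
            (((continuous_offset K).comp continuous_subtype_val).subtype_mk _))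
          (HFiber.continuous_point.comp continuous_subtype_val)) }
  left_inv := by
    convert ContinuousMap.Homotopic.refl _
    ext1 ⟨j, x⟩
    refine Sigma.ext (((Equiv.ofInjective φ hφ).symm_apply_eq.2 (Subtype.ext ?_)).symm) HEq.rfl
    exact ((offset_twist K x _).trans (D.loopEquiv_symm_apply _))
  right_inv := by
    let H := (exists_homotopy_twist K).choose
    obtain ⟨h0, h1⟩ := (exists_homotopy_twist K).choose_spec
    -- The offset is continuous with discrete values, hence constant along tracks of `H`, so `H`
    -- restricts to the chosen part.
    have hH : ∀ s y, offset K (H (s, y)) = offset K y := fun s y => by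
      rw [← congrArg (offset K) (h1 y)]
      exact PreconnectedSpace.constant (Y := G) inferInstance
        (f := fun s : I => offset K (H (s, y)))
        ((continuous_offset K).comp (by fun_prop))
    refine ⟨{ toFun := fun x => ⟨H (x.1, x.2.1), by
                rw [hH]
                exact x.2.2⟩
              continuous_toFun := by fun_prop
              map_zero_left := fun y => ?_
              map_one_left := fun y => Subtype.ext (h1 y.1) }⟩
    refine Subtype.ext ((h0 y.1).trans ?_)
    simp [Equiv.apply_ofInjective_symm hφ]

end Nullhomotopic

/-- If `p : E' → E` is a proper map, `f ∘ p` is null-homotopic and each point of the homotopy fiber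
of `f` lifts uniquely to a point of the homotopy fiber of `f ∘ p` with offset
among `k` given elements of `G`, then `k E' → E → X` is a fiber sequence. -/
theorem isFiberSequence_of_existsUnique_lift {G : Type*} [AddGroup G] [TopologicalSpace G]
    [DiscreteTopology G] {X E E' : Type*} [TopologicalSpace X] [TopologicalSpace E]
    [TopologicalSpace E'] {D : Delooping G X} {f : C(E, X)} {p : C(E', E)} (hp : IsProperMap p)
    (K : (f.comp p).Homotopy (ContinuousMap.const E' D.base)) {k : ℕ} {φ : Fin k → G}
    (hφ : Function.Injective φ)
    (hlift : ∀ y : HFiber f D.base,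
      ∃! y' : HFiber (f.comp p) D.base, HFiber.total p y' = y ∧ offset K y' ∈ Set.range φ) :
    IsFiberSequence (copiesMap k p) f D.base := by
  let q : {y : HFiber (f.comp p) D.base // offset K y ∈ Set.range φ} → HFiber f D.base :=
    fun y => HFiber.total p y.1
  have hq : Function.Bijective q := by
    refine ⟨fun y y' hy => ?_, fun y => ?_⟩
    · exact Subtype.ext ((hlift (q y')).unique ⟨hy, y.2⟩ ⟨rfl, y'.2⟩)
    · obtain ⟨y', hy', -⟩ := hlift y
      exact ⟨⟨y', hy'.2⟩, hy'.1⟩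
  -- The chosen part is closed because the offset is continuous into a discrete space; a continuous
  -- closed bijection is a homeomorphism.
  have hcl : IsClosedMap q := (HFiber.isClosedMap_total hp).comp
    ((isClosed_discrete (Set.range φ)).preimage (continuous_offset K)).isClosedMap_subtype_val
  let Q := (Equiv.ofBijective q hq).toHomeomorphOfContinuousClosed
    ((HFiber.continuous_total p).comp continuous_subtype_val) hcl
  -- On the `j`-th copy, the null-homotopy follows `K` and then the loop chosen for `φ j`, so that
  -- the induced map is the composite equivalence by definition.
  let W : ∀ x : Copies k E', Path (f (p x.2)) D.base := fun x =>
    (nullPath K x.2).trans (D.loopEquiv.symm (φ x.1))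
  have hW : Continuous ↿W := by
    refine Path.trans_continuous_family _ ?_ _ ?_
    · exact continuous_nullPath K (continuous_sigma fun _ => continuous_id)
    · exact Path.continuous_uncurry_iff.2 (continuous_sigma fun j =>
        continuous_const (y := D.loopEquiv.symm (φ j)))
  refine ⟨{ toFun := fun x => W x.2 x.1
            continuous_toFun := hW.comp continuous_swap
            map_zero_left := fun x => (W x).source
            map_one_left := fun x => (W x).target },
    (offsetEquiv K hφ).trans Q.toHomotopyEquiv, ?_⟩
  ext1 x
  rfl

/-! ### Classes of conjugated loops -/

section Conjugation

variable {G : Type*} [AddCommGroup G] [TopologicalSpace G] [DiscreteTopology G]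
  {X : Type*} [TopologicalSpace X] (D : Delooping G X)

open Path.Homotopic.Quotient in
-- The two loops are conjugate by the loop `β⁻¹ ⬝ α`, which is invisible in the commutative group
-- `G`.
theorem loopEquiv_conj {x x' : X} (hx : x = x') (p : Path x x) (p' : Path x' x')
    (hp : ∀ t, p t = p' t) (α : Path x D.base) (β : Path x' D.base) :
    D.loopEquiv (α.symm.trans (p.trans α)) = D.loopEquiv (β.symm.trans (p'.trans β)) := by
  subst hx
  obtain rfl : p = p' := Path.ext (funext hp)
  have h : (α.symm.trans (p.trans α)).Homotopic
      ((β.symm.trans α).symm.trans ((β.symm.trans (p.trans β)).trans (β.symm.trans α))) := by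
    rw [← Path.Homotopic.Quotient.eq]
    simp only [Path.trans_symm, Path.symm_symm, mk_trans, mk_symm, trans_assoc]
    rw [← trans_assoc (mk β) (symm (mk β)), trans_symm, refl_trans,
      ← trans_assoc (mk β) (symm (mk β)), trans_symm, refl_trans]
  rw [D.loopEquiv_eq_iff.2 h, D.loopEquiv_trans, D.loopEquiv_trans, D.loopEquiv_symm]
  abel

open Path.Homotopic.Quotient in
-- From `K ≃ μ ⬝ K'` follows `K'⁻¹ ≃ K⁻¹ ⬝ μ`; inserting `K ⬝ K⁻¹` before `γ` splits the class. The
-- path `ν` is `μ` viewed as a loop, since its endpoints are only propositionally equal.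
theorem loopEquiv_symm_trans_of_homotopic {x x' : X} (hx : x' = x) {K : Path x D.base}
    {K' : Path x' D.base} (μ : Path x x') (hμ : (μ.trans K').Homotopic K) (ν : Path x x)
    (hν : ∀ t, ν t = μ t) (γ : Path x D.base) (γ' : Path x' D.base) (hγ : ∀ t, γ' t = γ t) :
    D.loopEquiv (K'.symm.trans γ') =
      D.loopEquiv (K.symm.trans (ν.trans K)) + D.loopEquiv (K.symm.trans γ) := by
  subst hx
  obtain rfl : ν = μ := Path.ext (funext hν)
  obtain rfl : γ' = γ := Path.ext (funext hγ)
  rw [← D.loopEquiv_trans, D.loopEquiv_eq_iff]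
  rw [← Path.Homotopic.Quotient.eq] at hμ ⊢
  simp only [mk_trans, mk_symm] at hμ ⊢
  have h : symm (mk K') = (symm (mk K)).trans (mk ν) := by
    calc symm (mk K') = ((symm (mk K)).trans ((mk ν).trans (mk K'))).trans (symm (mk K')) := by
          rw [hμ, symm_trans, refl_trans]
      _ = _ := by simp only [trans_assoc, trans_symm, trans_refl]
  rw [h]
  simp only [trans_assoc]
  rw [← trans_assoc (mk K) (symm (mk K)), trans_symm, refl_trans]

end Conjugation

/-! ### Maps out of the circle -/

/-- A continuous surjection from a compact space to a Hausdorff one is a quotient map. The factor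
`I` lets homotopies descend to the circle. -/
theorem isQuotientMap_circleLoop :
    Topology.IsQuotientMap (Prod.map id (circleLoop 1) : I × I → I × Circle) := by
  have hs : Function.Surjective (circleLoop 1) := by
    intro z
    obtain ⟨θ, rfl⟩ := Circle.exp_surjective z
    refine ⟨⟨Int.fract (θ / (2 * Real.pi)), Int.fract_nonneg _, (Int.fract_lt_one _).le⟩, ?_⟩
    refine Circle.exp_eq_exp.2 ⟨-⌊θ / (2 * Real.pi)⌋, ?_⟩
    have h := Int.self_sub_floor (θ / (2 * Real.pi))
    simp only [← h]
    push_cast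
    field_simp
    ring
  have hc : Continuous (Prod.map id (circleLoop 1) : I × I → I × Circle) := by fun_prop
  exact hc.isClosedMap.isQuotientMap hc (Function.surjective_id.prodMap hs)

theorem eq_or_of_circleLoop_eq {t t' : I} (h : circleLoop 1 t = circleLoop 1 t') :
    t = t' ∨ t = 0 ∧ t' = 1 ∨ t = 1 ∧ t' = 0 := by
  obtain ⟨a, ha⟩ := Circle.exp_eq_exp.1 (h : Circle.exp _ = Circle.exp _)
  have hta : (t : ℝ) = t' + a := by
    have := Real.two_pi_pos.ne'
    apply mul_right_cancel₀ this
    push_cast at ha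
    linarith
  have h0 := t.2.1
  have h1 := t.2.2
  have h0' := t'.2.1
  have h1' := t'.2.2
  have hl : -1 ≤ a := by
    have : (-1 : ℝ) ≤ a := by linarith
    exact_mod_cast this
  have hr : a ≤ 1 := by
    have : (a : ℝ) ≤ 1 := by linarith
    exact_mod_cast this
  simp only [Subtype.ext_iff, Set.Icc.coe_zero, Set.Icc.coe_one]
  obtain rfl | rfl | rfl : a = -1 ∨ a = 0 ∨ a = 1 := by omega
  · push_cast at hta
    exact Or.inr (Or.inl ⟨by linarith, by linarith⟩)
  · exact Or.inl (by simpa using hta)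
  · push_cast at hta
    exact Or.inr (Or.inr ⟨by linarith, by linarith⟩)

/-- Maps out of the circle with homotopic associated loops are homotopic. -/
theorem homotopic_of_loop_homotopic {Y : Type*} [TopologicalSpace Y] {h h' : C(Circle, Y)} {y : Y}
    {p q : Path y y} (hp : ∀ t, p t = h (circleLoop 1 t)) (hq : ∀ t, q t = h' (circleLoop 1 t))
    (hpq : p.Homotopic q) : h.Homotopic h' := by
  obtain ⟨F⟩ := hpq
  have hF : Function.FactorsThrough F.toContinuousMap
      (⟨_, isQuotientMap_circleLoop.continuous⟩ : C(I × I, I × Circle)) := by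
    rintro ⟨s, t⟩ ⟨s', t'⟩ hst
    obtain ⟨rfl, ht⟩ := Prod.ext_iff.1 hst
    change F (s, t) = F (s, t')
    rcases eq_or_of_circleLoop_eq ht with rfl | ⟨rfl, rfl⟩ | ⟨rfl, rfl⟩ <;> simp
  let L : C(I × Circle, Y) := Topology.IsQuotientMap.lift
    (f := ⟨_, isQuotientMap_circleLoop.continuous⟩) isQuotientMap_circleLoop F.toContinuousMap hF
  have hL : ∀ s t, L (s, circleLoop 1 t) = F (s, t) := fun s t =>
    DFunLike.congr_fun (Topology.IsQuotientMap.lift_comp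
      (f := ⟨_, isQuotientMap_circleLoop.continuous⟩) isQuotientMap_circleLoop
      F.toContinuousMap hF) (s, t)
  have hs : ∀ z, ∃ t, circleLoop 1 t = z := fun z => by
    obtain ⟨⟨_, t⟩, ht⟩ := isQuotientMap_circleLoop.surjective ((0 : I), z)
    exact ⟨t, (Prod.ext_iff.1 ht).2⟩
  refine ⟨{ toContinuousMap := L, map_zero_left := fun z => ?_, map_one_left := fun z => ?_ }⟩ <;>
  obtain ⟨t, rfl⟩ := hs z
  · exact (hL 0 t).trans ((F.apply_zero t).trans (hp t))
  · exact (hL 1 t).trans ((F.apply_one t).trans (hq t))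

/-- The `n`-th power map of the circle. -/
def powMap (n : ℕ) : C(Circle, Circle) := ⟨fun z => z ^ n, by fun_prop⟩

theorem exp_pow (n : ℕ) (θ : ℝ) : Circle.exp θ ^ n = Circle.exp (n * θ) := by
  rw [Circle.exp_natCast_mul]

theorem circleLoop_pow (n : ℕ) (t : I) : circleLoop n t = circleLoop 1 t ^ n := by
  change Circle.exp _ = Circle.exp _ ^ n
  rw [exp_pow]
  congr 1
  push_cast
  ring

/-- Multiplying by the base path deforms `g` to `g'`, which fixes `1`. The track of `1` is the base
path `β`, so the loop of `g'` is homotopic to `g.loopMap (circleLoop 1)` and winds `n` times, as the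
power map does. -/
theorem homotopic_powMap {n : ℕ} (g : PointedMap circleDelooping.base circleDelooping.base)
    (hg : Deloops circleDelooping circleDelooping g (AddMonoidHom.mulLeft (n : ℤ))) :
    g.toMap.Homotopic (powMap n) := by
  let β : Path (g.toMap 1) 1 := g.basePath
  let g' : C(Circle, Circle) := ⟨fun z => (g.toMap 1)⁻¹ * g.toMap z, by fun_prop⟩
  let F : g.toMap.Homotopy g' :=
    { toFun := fun x => β x.1 * ((g.toMap 1)⁻¹ * g.toMap x.2)
      continuous_toFun := by fun_prop
      map_zero_left := fun z => by simp
      map_one_left := fun z => by simp [g'] }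
  let p : Path (g.toMap 1) (g.toMap 1) := (circleLoop 1).map g.toMap.continuous
  let q : Path (1 : Circle) 1 :=
    { toFun := fun t => g' (circleLoop 1 t)
      continuous_toFun := by fun_prop
      source' := by simp [g']
      target' := by simp [g'] }
  have hF : ∀ t, β t * ((g.toMap 1)⁻¹ * g.toMap 1) = β t := fun t => by simp
  have hsq : (p.trans β).Homotopic (β.trans q) :=
    homotopic_of_square (fun x => F (x.1, circleLoop 1 x.2)) (by fun_prop) p β β q
      (fun t => (F.apply_zero _).symm)
      (fun t => by
        rw [(circleLoop 1).target]
        exact (hF t).symm) (fun t => by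
        rw [(circleLoop 1).source]
        exact (hF t).symm)
      (fun t => (F.apply_one _).symm)
  have hq : (β.symm.trans (p.trans β)).Homotopic q :=
    ((Path.Homotopic.refl _).hcomp hsq).trans ((Path.Homotopic.trans_assoc _ _ _).symm.trans
      (((Path.Homotopic.symm_trans β).hcomp (.refl q)).trans (Path.Homotopic.refl_trans q)))
  have hwq : winding q = n := by
    have h1 := circleDelooping.loopEquiv_eq_iff.2 hq
    have h2 : winding (β.symm.trans (p.trans β)) = n * winding (circleLoop 1) := hg (circleLoop 1)
    rw [winding_circleLoop, mul_one] at h2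
    exact h1.symm.trans h2
  refine ContinuousMap.Homotopic.trans ⟨F⟩ (homotopic_of_loop_homotopic (p := q)
    (q := circleLoop n) (fun t => rfl) (circleLoop_pow n) ?_)
  exact circleDelooping.loopEquiv_eq_iff.1 (hwq.trans (winding_circleLoop n).symm)

/-- The loop `t ↦ x * exp (2 π a t i)` of the circle. -/
def rotatedLoop (x : Circle) (a : ℤ) : Path x x where
  toFun t := x * circleLoop a t
  continuous_toFun := by fun_prop
  source' := by simp
  target' := by simp

/-! ### Null-homotopies over the power map and the effect of rotations -/

section PowMap

variable {G : Type*} [AddCommGroup G] [TopologicalSpace G] [DiscreteTopology G]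
  {X : Type*} [TopologicalSpace X] {D : Delooping G X} {f : PointedMap circleDelooping.base D.base}
  {c : G}

theorem loopEquiv_loopMap
    (hf : Deloops circleDelooping D f (zmultiplesHom G c)) (p : Path (1 : Circle) 1) :
    D.loopEquiv (f.loopMap p) = winding p • c :=
  hf p

/-- The loop of the composite has class `n • c = 0` after conjugation by `β`, hence is
null-homotopic; the constant at `f 1` then slides along `β` to the base point. -/
theorem comp_powMap_nullhomotopic
    (hf : Deloops circleDelooping D f (zmultiplesHom G c)) {n : ℕ} (hn : n • c = 0) :
    (f.toMap.comp (powMap n)).Homotopic (ContinuousMap.const Circle D.base) := by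
  let β : Path (f.toMap 1) D.base := f.basePath
  let p : Path (f.toMap 1) (f.toMap 1) := (circleLoop n).map f.toMap.continuous
  have h : (β.symm.trans (p.trans β)).Homotopic (Path.refl D.base) := by
    rw [← D.loopEquiv_eq_iff, D.loopEquiv_refl]
    refine (loopEquiv_loopMap hf (circleLoop n)).trans ?_
    rw [winding_circleLoop, natCast_zsmul, hn]
  have hp : p.Homotopic (Path.refl _) := by
    rw [← Path.Homotopic.Quotient.eq] at h ⊢
    simp only [Path.Homotopic.Quotient.mk_trans, Path.Homotopic.Quotient.mk_symm,
      Path.Homotopic.Quotient.mk_refl] at h ⊢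
    have h' := congrArg (fun u => (Path.Homotopic.Quotient.mk β).trans
      (u.trans (Path.Homotopic.Quotient.mk β).symm)) h
    simp only [Path.Homotopic.Quotient.trans_assoc, Path.Homotopic.Quotient.trans_symm,
      Path.Homotopic.Quotient.trans_refl, Path.Homotopic.Quotient.refl_trans] at h'
    rwa [← Path.Homotopic.Quotient.trans_assoc, Path.Homotopic.Quotient.trans_symm,
      Path.Homotopic.Quotient.refl_trans] at h'
  refine (homotopic_of_loop_homotopic (h' := ContinuousMap.const Circle (f.toMap 1))
    (p := p) (q := Path.refl _) (fun t => ?_) (fun t => rfl) hp).trans ?_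
  · exact congrArg f.toMap (circleLoop_pow n t)
  · exact ⟨β.toHomotopyConst⟩

/-- The class is locally constant in `z` and the circle is connected, so `z = 1` suffices; there
`nullPath K 1` may be replaced by the base path of `f`. -/
theorem loopEquiv_nullPath_rotatedLoop
    (hf : Deloops circleDelooping D f (zmultiplesHom G c)) {n : ℕ}
    (K : (f.toMap.comp (powMap n)).Homotopy (ContinuousMap.const Circle D.base))
    (a : ℤ) (z : Circle) :
    D.loopEquiv ((nullPath K z).symm.trans
      (((rotatedLoop (z ^ n) a).map f.toMap.continuous).trans (nullPath K z))) = a • c := by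
  let u : Circle → Path D.base D.base := fun z => (nullPath K z).symm.trans
      (((rotatedLoop (z ^ n) a).map f.toMap.continuous).trans (nullPath K z))
  have hu : Continuous u := by
    rw [← Path.continuous_uncurry_iff]
    have hK := continuous_nullPath K continuous_id
    refine Path.trans_continuous_family _ (Path.symm_continuous_family _ hK) _
      (Path.trans_continuous_family _ ?_ _ hK)
    have : Continuous fun x : Circle × I => f.toMap (x.1 ^ n * circleLoop a x.2) := by fun_prop
    exact this
  have : PathConnectedSpace Circle := circleDelooping.connected
  have h1 := PreconnectedSpace.constant (Y := G) inferInstance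
    (f := fun z => D.loopEquiv (u z)) (D.loopEquiv.continuous.comp hu) (x := z) (y := 1)
  refine h1.trans ((loopEquiv_conj D (x' := f.toMap 1) (congrArg f.toMap (one_pow n)) _
    ((circleLoop a).map f.toMap.continuous) (fun t => ?_) _ f.basePath).trans ?_)
  · change f.toMap (1 ^ n * circleLoop a t) = _
    simp
  · exact (loopEquiv_loopMap hf (circleLoop a)).trans (by rw [winding_circleLoop])

/-- The `n`-th power carries the arc from `y.point` to `y'.point` to a loop winding `a` times. The
homotopy `K` over this arc is a square comparing the two null-paths. -/
theorem offset_rotate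
    (hf : Deloops circleDelooping D f (zmultiplesHom G c)) {n : ℕ}
    (K : (f.toMap.comp (powMap n)).Homotopy (ContinuousMap.const Circle D.base))
    (hn : n ≠ 0) (a : ℤ) {y y' : HFiber (f.toMap.comp (powMap n)) D.base}
    (hz : y'.point = y.point * Circle.exp (a * (2 * Real.pi) / n))
    (hpath : ∀ t, y'.path t = y.path t) : offset K y' = a • c + offset K y := by
  let arc : I → Circle := fun t => y.point * Circle.exp (t * (a * (2 * Real.pi) / n))
  have harc : Continuous arc := by fun_prop
  let μ : Path (f.toMap (powMap n y.point)) (f.toMap (powMap n y'.point)) :=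
    { toFun := fun t => f.toMap (powMap n (arc t))
      continuous_toFun := by fun_prop
      source' := by simp [arc]
      target' := by simp [arc, hz] }
  have hμ : (μ.trans (nullPath K y'.point)).Homotopic (nullPath K y.point) :=
    (homotopic_of_square (fun x => K (x.1, arc x.2)) (by fun_prop) μ (nullPath K y'.point)
      (nullPath K y.point) (Path.refl D.base) (fun t => (K.apply_zero _).symm)
      (fun t => by simp [arc, ← hz, nullPath]; rfl) (fun t => by simp [arc, nullPath]; rfl)
      (fun t => (K.apply_one _).symm)).trans (Path.Homotopic.trans_refl _)
  rw [← loopEquiv_nullPath_rotatedLoop hf K a y.point]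
  refine loopEquiv_symm_trans_of_homotopic D ?_ μ hμ _ (fun t => ?_) _ _ hpath
  · have := (hpath 0).symm
    rwa [y.path.source, y'.path.source, eq_comm] at this
  · change f.toMap (y.point ^ n * Circle.exp (t * (a * (2 * Real.pi)))) =
      f.toMap ((y.point * Circle.exp (t * (a * (2 * Real.pi) / n))) ^ n)
    rw [mul_pow, exp_pow]
    congr 3
    field_simp

end PowMap

theorem exists_eq_mul_exp_of_pow_eq {n : ℕ} (hn : n ≠ 0) {z z' : Circle} (h : z' ^ n = z ^ n) :
    ∃ a : ℤ, z' = z * Circle.exp (a * (2 * Real.pi) / n) := by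
  obtain ⟨θ, rfl⟩ := Circle.exp_surjective z
  obtain ⟨θ', rfl⟩ := Circle.exp_surjective z'
  rw [exp_pow, exp_pow, Circle.exp_eq_exp] at h
  obtain ⟨a, ha⟩ := h
  refine ⟨a, ?_⟩
  rw [← Circle.exp_add]
  congr 1
  field_simp
  linarith

/-- If `φ` enumerates representatives of the cosets of the subgroup generated by `c`, of order `n`,
then `k S¹ → S¹ → X`, given by the `n`-th power map, is a fiber sequence. -/
theorem isFiberSequence_copies_powMap {G : Type*} [AddCommGroup G] [TopologicalSpace G]
    [DiscreteTopology G] {X : Type*} [TopologicalSpace X] {D : Delooping G X}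
    {f : PointedMap circleDelooping.base D.base} {c : G}
    (hf : Deloops circleDelooping D f (zmultiplesHom G c)) {n k : ℕ} (hn : n ≠ 0)
    (hc : n • c = 0) {φ : Fin k → G} (hφ : Function.Injective φ)
    (hex : ∀ x : G, ∃ a : ℤ, a • c + x ∈ Set.range φ)
    (huniq : ∀ x ∈ Set.range φ, ∀ a : ℤ, a • c + x ∈ Set.range φ → (n : ℤ) ∣ a) :
    IsFiberSequence (copiesMap k (powMap n)) f.toMap D.base := by
  obtain ⟨K⟩ := comp_powMap_nullhomotopic hf hc
  refine isFiberSequence_of_existsUnique_lift (powMap n).continuous.isProperMap K hφ fun y => ?_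
  obtain ⟨θ, hθ⟩ := Circle.exp_surjective y.point
  have lift : ∀ z : Circle, z ^ n = y.point →
      ∃ y' : HFiber (f.toMap.comp (powMap n)) D.base, HFiber.total (powMap n) y' = y ∧
        y'.point = z ∧ ∀ t, y'.path t = y.path t := by
    intro z hz
    refine ⟨HFiber.mk z (y.path.cast (congrArg f.toMap hz) rfl), HFiber.ext hz fun t => rfl,
      rfl, fun t => rfl⟩
  have hroot : Circle.exp (θ / n) ^ n = y.point := by
    rw [exp_pow, ← hθ]
    congr 1
    field_simp
  obtain ⟨y₀, -, hy₀, hy₀'⟩ := lift _ hroot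
  -- An arbitrary lift is rotated until its offset is one of the representatives.
  obtain ⟨a, ha⟩ := hex (offset K y₀)
  obtain ⟨y₁, hy₁, hy₁', hy₁''⟩ := lift (Circle.exp (θ / n) * Circle.exp (a * (2 * Real.pi) / n)) (by
    rw [mul_pow, hroot, exp_pow]
    have : (n : ℝ) * (a * (2 * Real.pi) / n) = a * (2 * Real.pi) := by field_simp
    rw [this, Circle.exp_int_mul_two_pi, mul_one])
  have hoff : offset K y₁ ∈ Set.range φ := by
    rw [offset_rotate hf K hn a (y := y₀) (by rw [hy₁', hy₀]) (fun t => by rw [hy₁'', hy₀'])]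
    exact ha
  refine ⟨y₁, ⟨hy₁, hoff⟩, fun y₂ ⟨hy₂, hoff₂⟩ => ?_⟩
  have hpow : y₂.point ^ n = y₁.point ^ n := congrArg HFiber.point (hy₂.trans hy₁.symm)
  have hpath : ∀ t, y₂.path t = y₁.path t := fun t =>
    congrArg (fun w : HFiber f.toMap D.base => w.path t) (hy₂.trans hy₁.symm)
  obtain ⟨b, hb⟩ := exists_eq_mul_exp_of_pow_eq hn hpow
  rw [offset_rotate hf K hn b hb hpath] at hoff₂
  -- Both offsets are representatives, so the rotation is by a whole number of turns.
  obtain ⟨d, rfl⟩ := huniq _ hoff b hoff₂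
  refine HFiber.ext ?_ hpath
  have : ((n * d : ℤ) : ℝ) * (2 * Real.pi) / n = d * (2 * Real.pi) := by
    push_cast
    field_simp
  rw [hb, this, Circle.exp_int_mul_two_pi, mul_one]

end FibSeq

end

/-! ### Cosets of the subgroup generated by `l` in `ℤ/m` -/

theorem mainTheorem5 {X : Type*} [TopologicalSpace X] (m : ℕ) (hm : 0 < m) (l : ℤ)
    (BZm : FibSeq.Delooping (ZMod m) X)
    (f : FibSeq.PointedMap FibSeq.circleDelooping.base BZm.base)
    (hf : FibSeq.Deloops FibSeq.circleDelooping BZm f (zmultiplesHom (ZMod m) (l : ZMod m))) :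
    Nonempty (ContinuousMap.HomotopyEquiv (FibSeq.HFiber f.toMap BZm.base)
      (FibSeq.Copies (Int.gcd l m) Circle)) ∧
    ∀ g : FibSeq.PointedMap FibSeq.circleDelooping.base FibSeq.circleDelooping.base,
      FibSeq.Deloops FibSeq.circleDelooping FibSeq.circleDelooping g
        (AddMonoidHom.mulLeft ((m / Int.gcd l m : ℕ) : ℤ)) →
      FibSeq.IsFiberSequence (FibSeq.copiesMap (Int.gcd l m) g.toMap) f.toMap BZm.base := by
  have key : FibSeq.IsFiberSequence
      (FibSeq.copiesMap (Int.gcd l m) (FibSeq.powMap (m / Int.gcd l m))) f.toMap BZm.base := by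
    set k := Int.gcd l m with hk
    have hk0 : 0 < k := Int.gcd_pos_of_ne_zero_right _ (by exact_mod_cast hm.ne')
    have hkm : k ∣ m := by exact_mod_cast (Int.gcd_dvd_right l m)
    have hkl : (k : ℤ) ∣ l := Int.gcd_dvd_left l m
    obtain ⟨n, hn⟩ := hkm
    obtain ⟨l', hl'⟩ := hkl
    have hn0 : n ≠ 0 := by
      rintro rfl
      omega
    have hmk : m / k = n := by rw [hn, Nat.mul_div_cancel_left _ hk0]
    have hkm : k ≤ m := Nat.le_of_dvd hm ⟨n, hn⟩
    rw [hmk]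
    have hcast : ∀ a b : ℤ, (a : ZMod m) = b ↔ (m : ℤ) ∣ a - b := fun a b => by
      rw [eq_comm, ZMod.intCast_eq_intCast_iff_dvd_sub]
    have hbez : (k : ℤ) = l * Int.gcdA l m + m * Int.gcdB l m := Int.gcd_eq_gcd_ab l m
    -- In `ℤ/m` the subgroups generated by `l` and `k` agree, so `0, …, k - 1` represent the cosets.
    refine FibSeq.isFiberSequence_copies_powMap (φ := fun j : Fin k => ((j : ℤ) : ZMod m)) hf hn0
      ?_ ?_ ?_ ?_
    · rw [nsmul_eq_mul]
      have := (hcast (n * l) 0).2 ⟨l', by rw [hn, hl']; push_cast; ring⟩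
      push_cast at this
      exact this
    · intro i j hij
      obtain ⟨d, hd⟩ := (hcast _ _).1 hij
      have := Int.eq_zero_of_abs_lt_dvd ⟨d, hd⟩ (by rw [abs_lt]; omega)
      omega
    · intro x
      obtain ⟨x, rfl⟩ := ZMod.intCast_surjective x
      -- Modulo `m`, `k = l * gcdA l m` by Bézout, so this multiple of `l` subtracts `(x / k) * k`
      -- from `x`.
      refine ⟨-(x / k) * Int.gcdA l m, ⟨(x % k).toNat, ?_⟩, ?_⟩
      · have := Int.emod_lt_of_pos x (b := k) (by omega)
        have := Int.emod_nonneg x (b := k) (by omega)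
        omega
      · have h0 := Int.emod_nonneg x (b := k) (by omega)
        simp only [Int.toNat_of_nonneg h0, zsmul_eq_mul]
        rw [← Int.cast_mul, ← Int.cast_add, hcast]
        refine ⟨-(x / k) * Int.gcdB l m, ?_⟩
        have := Int.emod_add_mul_ediv x k
        linear_combination this - (x / k) * hbez
    · rintro _ ⟨i, rfl⟩ a ⟨j, hj⟩
      simp only [zsmul_eq_mul] at hj
      rw [← Int.cast_mul, ← Int.cast_add, hcast] at hj
      obtain ⟨d, hd⟩ := hj
      -- Both `l` and `m` vanish modulo `k`, so `i` and `j` are congruent modulo `k`, and both are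
      -- less than `k`.
      have hij : (j : ℤ) - i = 0 := by
        refine Int.eq_zero_of_abs_lt_dvd (m := k) ⟨n * d + a * l', ?_⟩ (by rw [abs_lt]; omega)
        rw [hl', hn] at hd
        push_cast at hd
        linear_combination hd
      have hal : (n : ℤ) ∣ a * l' := by
        refine ⟨-d, mul_left_cancel₀ (a := (k : ℤ)) (by omega) ?_⟩
        rw [hl', hn] at hd
        push_cast at hd
        linear_combination hij - hd
      -- Dividing Bézout's identity by `k` shows that `n` and `l'` are coprime.
      refine Int.dvd_of_dvd_mul_left_of_gcd_one hal ?_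
      rw [Int.gcd_comm, ← Int.isCoprime_iff_gcd_eq_one]
      refine ⟨Int.gcdA l m, Int.gcdB l m, mul_left_cancel₀ (a := (k : ℤ)) (by omega) ?_⟩
      have hn' : (m : ℤ) = k * n := by exact_mod_cast hn
      linear_combination -hbez - Int.gcdA l m * hl' - Int.gcdB l m * hn'
  refine ⟨?_, fun g hg => key.of_homotopic ?_⟩
  · obtain ⟨-, e, -⟩ := key
    exact ⟨e.symm⟩
  · exact (FibSeq.homotopic_powMap g hg).comp (ContinuousMap.Homotopic.refl
      (FibSeq.copiesMap (Int.gcd l m) (ContinuousMap.id Circle)))
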